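/- Let $\mathcal H$ and $\mathcal K$ be complex Hilbert spaces, and for self-adjoint bounded operators write $X\le Y$ if $Y-X$ is positive (semidefinite). For positive invertible operators $A,B$ on the same Hilbert space and $p\in\mathbb R$ put $$A\,\natural_p\,B=A^{1/2}\bigl(A^{-1/2}BA^{-1/2}\bigr)^pA^{1/2},$$ also written $A\,\sharp_p\,B$ when $0\le p\le 1$. Let $A,B\in\mathcal B(\mathcal H)$ be positive operators with $A$ invertible, and let $m,M$ be real numbers, $m>0$, such that $$m\mathbf 1_{\mathcal H}\le \mathbf 1_{\mathcal H}\le A^{-1/2}BA^{-1/2}\le M\mathbf 1_{\mathcal H}$$ (so that $B$ is invertible too). Let $\Phi:\mathcal B(\mathcal H)\to\mathcal B(\mathcal K)$ be a unital positive linear map (for instance with $\mathcal K=\mathcal H$). Then: 1. if $0\le p\le 1$, then $\Phi(A)\,\sharp_p\,\Phi(B)\le \Phi(A\,\sharp_p\,B)+p\,(m^{p-1}-M^{p-1})\,\Phi(B-A)$; 2. if $-1\le p\le 0$, then $\Phi(A)\,\natural_p\,\Phi(B)\ge \Phi(A\,\natural_p\,B)+p\,(m^{p-1}-M^{p-1})\,\Phi(B-A)$;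 3. if $1\le p\le 2$, then $\Phi(A\,\natural_p\,B)\le \Phi(A)\,\natural_p\,\Phi(B)+p\,(M^{p-1}-m^{p-1})\,\Phi(B-A)$. -/

import Mathlib

/-- The weighted operator mean `A ♮_p B = A^{1/2} (A^{-1/2} B A^{-1/2})^p A^{1/2}` of two positive
invertible bounded operators on a complex Hilbert space, for a real parameter `p`
(also written `A ♯_p B` when `0 ≤ p ≤ 1`). Real powers are those of the continuous functional
calculus. -/
noncomputable def operatorMean {H : Type*} [NormedAddCommGroup H] [InnerProductSpace ℂ H]
    [CompleteSpace H] (p : ℝ) (A B : H →L[ℂ] H) : H →L[ℂ] H :=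
  A ^ (1 / 2 : ℝ) * (A ^ (-(1 / 2) : ℝ) * B * A ^ (-(1 / 2) : ℝ)) ^ p * A ^ (1 / 2 : ℝ)

section Scalar

/-! For `1 ≤ t ≤ M`, `t ^ p` lies between the lines through `(1, 1)` of slopes `p` and `p * M ^ (p -
1)`. Functional calculus and conjugation by `A ^ (1/2)` turn a line of slope `c` into `A + c • (B -
A)`, which `Φ` respects. The mean of `A, B` is compared with slope `p * M ^ (p - 1)`, that of `Φ A,
Φ B` with slope `p`. As `Φ (B - A) ≥ 0`, only the slopes remain to be compared, and `m ≤ 1` settles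
that; no operator concavity or convexity is needed. -/

theorem Real.rpow_le_one_add_mul_sub_one {t p : ℝ} (ht : 0 < t) (hp : 0 ≤ p) (hp1 : p ≤ 1) :
    t ^ p ≤ 1 + p * (t - 1) := by
  simpa using rpow_one_add_le_one_add_mul_self (s := t - 1) (by linarith) hp hp1

theorem Real.one_add_mul_sub_one_le_rpow {t p : ℝ} (ht : 0 < t) (hp : p ≤ 0 ∨ 1 ≤ p) :
    1 + p * (t - 1) ≤ t ^ p := by
  rcases hp with hp | hp
  -- Bernoulli at `t⁻¹` with exponent `1 - p ≥ 1`, then multiplied by `t`.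
  · have h := one_add_mul_self_le_rpow_one_add (s := t⁻¹ - 1) (p := 1 - p)
      (by linarith [inv_pos.2 ht]) (by linarith)
    rw [add_sub_cancel, Real.inv_rpow ht.le, ← Real.rpow_neg ht.le, neg_sub,
      Real.rpow_sub_one ht.ne', le_div_iff₀ ht] at h
    have e : (1 + (1 - p) * (t⁻¹ - 1)) * t = 1 + p * (t - 1) := by
      field_simp
      ring
    linarith
  · simpa using one_add_mul_self_le_rpow_one_add (s := t - 1) (by linarith) hp

/-- The reflection `t ↦ t⁻¹` turns the tangent at `1` into the tangent at `t`. -/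
theorem Real.rpow_mul_one_add_mul_inv_sub_one {t : ℝ} (ht : 0 < t) (p : ℝ) :
    t ^ p * (1 + p * (t⁻¹ - 1)) = t ^ p - p * t ^ (p - 1) * (t - 1) := by
  rw [Real.rpow_sub_one ht.ne']
  field_simp
  ring

theorem Real.one_add_mul_rpow_mul_sub_one_le_rpow {t p : ℝ} (ht : 0 < t) (hp : 0 ≤ p)
    (hp1 : p ≤ 1) : 1 + p * t ^ (p - 1) * (t - 1) ≤ t ^ p := by
  have h := mul_le_mul_of_nonneg_left
    (Real.rpow_le_one_add_mul_sub_one (inv_pos.2 ht) hp hp1) (Real.rpow_nonneg ht.le p)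
  rw [Real.rpow_mul_one_add_mul_inv_sub_one ht, Real.inv_rpow ht.le,
    mul_inv_cancel₀ (Real.rpow_pos_of_pos ht p).ne'] at h
  linarith

theorem Real.rpow_le_one_add_mul_rpow_mul_sub_one {t p : ℝ} (ht : 0 < t) (hp : p ≤ 0 ∨ 1 ≤ p) :
    t ^ p ≤ 1 + p * t ^ (p - 1) * (t - 1) := by
  have h := mul_le_mul_of_nonneg_left
    (Real.one_add_mul_sub_one_le_rpow (inv_pos.2 ht) hp) (Real.rpow_nonneg ht.le p)
  rw [Real.rpow_mul_one_add_mul_inv_sub_one ht, Real.inv_rpow ht.le,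
    mul_inv_cancel₀ (Real.rpow_pos_of_pos ht p).ne'] at h
  linarith

theorem Real.one_add_mul_rpow_bound_le_rpow {t M p : ℝ} (ht : 1 ≤ t) (htM : t ≤ M) (hp : 0 ≤ p)
    (hp1 : p ≤ 1) : 1 + p * M ^ (p - 1) * (t - 1) ≤ t ^ p := by
  have ht0 : 0 < t := by linarith
  refine le_trans ?_ (Real.one_add_mul_rpow_mul_sub_one_le_rpow ht0 hp hp1)
  have := Real.rpow_le_rpow_of_nonpos ht0 htM (show p - 1 ≤ 0 by linarith)
  have := sub_nonneg.2 ht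
  gcongr

/-- By convexity the chord from `1` to `t` is no steeper than the tangent at `t`, whose slope `p * t
^ (p - 1)` increases with `t`. -/
theorem Real.rpow_le_one_add_mul_rpow_bound {t M p : ℝ} (ht : 1 ≤ t) (htM : t ≤ M)
    (hp : p ≤ 0 ∨ 1 ≤ p) : t ^ p ≤ 1 + p * M ^ (p - 1) * (t - 1) := by
  have ht0 : 0 < t := by linarith
  refine (Real.rpow_le_one_add_mul_rpow_mul_sub_one ht0 hp).trans ?_
  have := sub_nonneg.2 ht
  gcongr 1 + ?_ * _
  rcases hp with hp | hp
  · exact mul_le_mul_of_nonpos_left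
      (Real.rpow_le_rpow_of_nonpos ht0 htM (show p - 1 ≤ 0 by linarith)) hp
  · have := Real.rpow_le_rpow ht0.le htM (show 0 ≤ p - 1 by linarith)
    gcongr

end Scalar

theorem map_real_smul_of_positive {H K : Type*} [NormedAddCommGroup H] [InnerProductSpace ℂ H]
    [NormedAddCommGroup K] [InnerProductSpace ℂ K]
    (Φ : (H →L[ℂ] H) →ₚ[ℂ] (K →L[ℂ] K)) (r : ℝ) (X : H →L[ℂ] H) :
    Φ (r • X) = r • Φ X := by
  rw [← Complex.coe_smul, map_smul, Complex.coe_smul]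

section OperatorMean

variable {H : Type*} [NormedAddCommGroup H] [InnerProductSpace ℂ H] [CompleteSpace H]

theorem IsStrictlyPositive.conjugate_rpow_half_neg_half {A : H →L[ℂ] H}
    (hA : IsStrictlyPositive A) (B : H →L[ℂ] H) :
    A ^ (1 / 2 : ℝ) * (A ^ (-(1 / 2) : ℝ) * B * A ^ (-(1 / 2) : ℝ)) * A ^ (1 / 2 : ℝ) = B := by
  have h1 := CFC.rpow_mul_rpow_neg (1 / 2) hA
  have h2 := CFC.rpow_neg_mul_rpow (1 / 2) hA
  calc _ = (A ^ (1 / 2 : ℝ) * A ^ (-(1 / 2) : ℝ)) * B *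
        (A ^ (-(1 / 2) : ℝ) * A ^ (1 / 2 : ℝ)) := by simp only [mul_assoc]
    _ = B := by rw [h1, h2, one_mul, mul_one]

theorem IsStrictlyPositive.rpow_half_mul_self {A : H →L[ℂ] H} (hA : IsStrictlyPositive A) :
    A ^ (1 / 2 : ℝ) * A ^ (1 / 2 : ℝ) = A := by
  rw [← CFC.rpow_add hA.isUnit, add_halves, CFC.rpow_one A hA.nonneg]

theorem IsStrictlyPositive.conjugate_one_add_smul {A : H →L[ℂ] H} (hA : IsStrictlyPositive A)
    (B : H →L[ℂ] H) (c : ℝ) :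
    A ^ (1 / 2 : ℝ) * (1 + c • (A ^ (-(1 / 2) : ℝ) * B * A ^ (-(1 / 2) : ℝ) - 1)) *
      A ^ (1 / 2 : ℝ) = A + c • (B - A) := by
  rw [mul_add, add_mul, mul_one, mul_smul_comm, smul_mul_assoc, mul_sub, sub_mul, mul_one,
    hA.conjugate_rpow_half_neg_half, hA.rpow_half_mul_self]

theorem one_add_smul_sub_one_eq_cfc {X : H →L[ℂ] H} (hX : IsSelfAdjoint X) (c : ℝ) :
    1 + c • (X - 1) = cfc (fun t : ℝ => 1 + c * (t - 1)) X := by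
  rw [cfc_const_add (R := ℝ) 1 (fun t => c * (t - 1)) X, cfc_const_mul c (fun t : ℝ => t - 1) X,
    cfc_sub (fun t : ℝ => t) (fun _ => 1) X, cfc_id' ℝ X, cfc_const_one ℝ X, map_one]

theorem continuousOn_rpow_spectrum {X : H →L[ℂ] H} (hX : 1 ≤ X) (p : ℝ) :
    ContinuousOn (fun t : ℝ => t ^ p) (spectrum ℝ X) := by
  have hX0 : IsSelfAdjoint X := .of_nonneg (zero_le_one.trans hX)
  intro t ht
  have := (CFC.one_le_iff X hX0).1 hX t ht
  exact (Real.continuousAt_rpow_const t p (Or.inl (by linarith))).continuousWithinAt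

theorem operatorMean_le_add_smul_sub {A B : H →L[ℂ] H} (hA : IsStrictlyPositive A) {p c : ℝ}
    (h1 : 1 ≤ A ^ (-(1 / 2) : ℝ) * B * A ^ (-(1 / 2) : ℝ))
    (h : ∀ t ∈ spectrum ℝ (A ^ (-(1 / 2) : ℝ) * B * A ^ (-(1 / 2) : ℝ)),
      t ^ p ≤ 1 + c * (t - 1)) :
    operatorMean p A B ≤ A + c • (B - A) := by
  have hX := zero_le_one.trans h1
  rw [← hA.conjugate_one_add_smul B c, operatorMean]
  refine conjugate_le_conjugate_of_nonneg ?_ CFC.rpow_nonneg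
  rw [CFC.rpow_eq_cfc_real hX, one_add_smul_sub_one_eq_cfc (.of_nonneg hX)]
  exact cfc_mono h (continuousOn_rpow_spectrum h1 p)

theorem add_smul_sub_le_operatorMean {A B : H →L[ℂ] H} (hA : IsStrictlyPositive A) {p c : ℝ}
    (h1 : 1 ≤ A ^ (-(1 / 2) : ℝ) * B * A ^ (-(1 / 2) : ℝ))
    (h : ∀ t ∈ spectrum ℝ (A ^ (-(1 / 2) : ℝ) * B * A ^ (-(1 / 2) : ℝ)),
      1 + c * (t - 1) ≤ t ^ p) :
    A + c • (B - A) ≤ operatorMean p A B := by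
  have hX := zero_le_one.trans h1
  rw [← hA.conjugate_one_add_smul B c, operatorMean]
  refine conjugate_le_conjugate_of_nonneg ?_ CFC.rpow_nonneg
  rw [CFC.rpow_eq_cfc_real hX, one_add_smul_sub_one_eq_cfc (.of_nonneg hX)]
  exact cfc_mono h (hg := continuousOn_rpow_spectrum h1 p)

theorem IsStrictlyPositive.le_of_one_le_conjugate {A B : H →L[ℂ] H} (hA : IsStrictlyPositive A)
    (h1 : 1 ≤ A ^ (-(1 / 2) : ℝ) * B * A ^ (-(1 / 2) : ℝ)) : A ≤ B := by
  have h := conjugate_le_conjugate_of_nonneg h1 (CFC.rpow_nonneg (a := A) (y := 1 / 2))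
  rwa [hA.conjugate_rpow_half_neg_half, mul_one, hA.rpow_half_mul_self] at h

theorem IsStrictlyPositive.one_le_conjugate_of_le {A B : H →L[ℂ] H} (hA : IsStrictlyPositive A)
    (hAB : A ≤ B) : 1 ≤ A ^ (-(1 / 2) : ℝ) * B * A ^ (-(1 / 2) : ℝ) := by
  have h := conjugate_le_conjugate_of_nonneg hAB (CFC.rpow_nonneg (a := A) (y := -(1 / 2)))
  rwa [CFC.conjugate_rpow_neg_one_half A hA] at h

variable {K : Type*} [NormedAddCommGroup K] [InnerProductSpace ℂ K] [CompleteSpace K]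

/-- A scalar lower bound `r • 1 ≤ A` with `r > 0` survives a unital positive map. -/
theorem IsStrictlyPositive.map_of_unital [Nontrivial (H →L[ℂ] H)]
    (Φ : (H →L[ℂ] H) →ₚ[ℂ] (K →L[ℂ] K)) (hΦ : Φ 1 = 1) {A : H →L[ℂ] H}
    (hA : IsStrictlyPositive A) : IsStrictlyPositive (Φ A) := by
  obtain ⟨r, hr, hrA⟩ :=
    (CFC.exists_pos_algebraMap_le_iff hA.isSelfAdjoint).2 fun x hx ↦ hA.spectrum_pos hx
  have h := OrderHomClass.mono Φ hrA
  rw [Algebra.algebraMap_eq_smul_one, map_real_smul_of_positive, hΦ] at h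
  exact (isStrictlyPositive_one.smul hr).of_le h

end OperatorMean

theorem corollary2p3
    {H : Type*} [NormedAddCommGroup H] [InnerProductSpace ℂ H] [CompleteSpace H]
    {K : Type*} [NormedAddCommGroup K] [InnerProductSpace ℂ K] [CompleteSpace K]
    (Φ : (H →L[ℂ] H) →ₚ[ℂ] (K →L[ℂ] K)) (hΦ : Φ 1 = 1)
    (A B : H →L[ℂ] H) (hA : IsStrictlyPositive A) (hB : 0 ≤ B)
    (m M : ℝ) (hm : 0 < m)
    (hm1 : m • (1 : H →L[ℂ] H) ≤ 1)
    (h1 : 1 ≤ A ^ (-(1 / 2) : ℝ) * B * A ^ (-(1 / 2) : ℝ))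
    (hM : A ^ (-(1 / 2) : ℝ) * B * A ^ (-(1 / 2) : ℝ) ≤ M • (1 : H →L[ℂ] H))
    (p : ℝ) :
    (0 ≤ p → p ≤ 1 →
      operatorMean p (Φ A) (Φ B) ≤
        Φ (operatorMean p A B) + (p * (m ^ (p - 1) - M ^ (p - 1))) • Φ (B - A)) ∧
    (-1 ≤ p → p ≤ 0 →
      Φ (operatorMean p A B) + (p * (m ^ (p - 1) - M ^ (p - 1))) • Φ (B - A) ≤
        operatorMean p (Φ A) (Φ B)) ∧
    (1 ≤ p → p ≤ 2 →
      Φ (operatorMean p A B) ≤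
        operatorMean p (Φ A) (Φ B) + (p * (M ^ (p - 1) - m ^ (p - 1))) • Φ (B - A)) := by
  rcases subsingleton_or_nontrivial (H →L[ℂ] H) with hH | hH
  -- If `1 = 0` on `H`, unitality forces `1 = 0` on `K`.
  · have : Subsingleton (K →L[ℂ] K) := subsingleton_of_zero_eq_one <| by
      rw [← hΦ, Subsingleton.elim (1 : H →L[ℂ] H) 0, map_zero]
    exact ⟨fun _ _ => (Subsingleton.elim _ _).le, fun _ _ => (Subsingleton.elim _ _).le,
      fun _ _ => (Subsingleton.elim _ _).le⟩
  have hm1' : m ≤ 1 := by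
    have h : algebraMap ℝ (H →L[ℂ] H) m ≤ 1 := by rwa [Algebra.algebraMap_eq_smul_one]
    rw [algebraMap_le_iff_le_spectrum (a := (1 : H →L[ℂ] H)) (.one _)] at h
    exact h 1 (by simp)
  set X := A ^ (-(1 / 2) : ℝ) * B * A ^ (-(1 / 2) : ℝ)
  have hX : IsSelfAdjoint X := .of_nonneg (zero_le_one.trans h1)
  have hspec1 : ∀ t ∈ spectrum ℝ X, 1 ≤ t := (CFC.one_le_iff X hX).1 h1
  have hspecM : ∀ t ∈ spectrum ℝ X, t ≤ M := by
    rwa [← Algebra.algebraMap_eq_smul_one, le_algebraMap_iff_spectrum_le hX] at hM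
  have hΦA := hA.map_of_unital Φ hΦ
  have hAB : A ≤ B := hA.le_of_one_le_conjugate h1
  have hΦX := hΦA.one_le_conjugate_of_le (OrderHomClass.mono Φ hAB)
  -- This lets inequalities between slopes pass to operators.
  have hD : 0 ≤ Φ (B - A) := by
    simpa using OrderHomClass.mono Φ (sub_nonneg.2 hAB)
  have hΦspec := (CFC.one_le_iff (R := ℝ) _ (.of_nonneg (zero_le_one.trans hΦX))).1 hΦX
  have hmap (c : ℝ) : Φ (A + c • (B - A)) = Φ A + c • Φ (B - A) := by
    rw [map_add, map_real_smul_of_positive]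
  refine ⟨fun hp hp1 => ?_, fun _ hp => ?_, fun hp _ => ?_⟩
  · have hlow := OrderHomClass.mono Φ <| add_smul_sub_le_operatorMean hA h1 fun t ht =>
      Real.one_add_mul_rpow_bound_le_rpow (hspec1 t ht) (hspecM t ht) hp hp1
    have hup := operatorMean_le_add_smul_sub hΦA hΦX fun t ht =>
      Real.rpow_le_one_add_mul_sub_one (zero_lt_one.trans_le (hΦspec t ht)) hp hp1
    rw [hmap] at hlow
    rw [← map_sub] at hup
    -- The `M` terms cancel, leaving `p ≤ p * m ^ (p - 1)`.
    have hc : p ≤ p * M ^ (p - 1) + p * (m ^ (p - 1) - M ^ (p - 1)) := by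
      have := Real.one_le_rpow_of_pos_of_le_one_of_nonpos hm hm1' (show p - 1 ≤ 0 by linarith)
      nlinarith
    calc _ ≤ Φ A + p • Φ (B - A) := hup
      _ ≤ Φ A + (p * M ^ (p - 1) + p * (m ^ (p - 1) - M ^ (p - 1))) • Φ (B - A) := by gcongr
      _ = Φ A + (p * M ^ (p - 1)) • Φ (B - A) +
          (p * (m ^ (p - 1) - M ^ (p - 1))) • Φ (B - A) := by rw [add_smul, add_assoc]
      _ ≤ _ := by gcongr
  · have hup := OrderHomClass.mono Φ <| operatorMean_le_add_smul_sub hA h1 fun t ht =>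
      Real.rpow_le_one_add_mul_rpow_bound (hspec1 t ht) (hspecM t ht) (Or.inl hp)
    have hlow := add_smul_sub_le_operatorMean hΦA hΦX fun t ht =>
      Real.one_add_mul_sub_one_le_rpow (zero_lt_one.trans_le (hΦspec t ht)) (Or.inl hp)
    rw [hmap] at hup
    rw [← map_sub] at hlow
    have hc : p * M ^ (p - 1) + p * (m ^ (p - 1) - M ^ (p - 1)) ≤ p := by
      have := Real.one_le_rpow_of_pos_of_le_one_of_nonpos hm hm1' (show p - 1 ≤ 0 by linarith)
      nlinarith
    calc _ ≤ Φ A + (p * M ^ (p - 1)) • Φ (B - A) +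
          (p * (m ^ (p - 1) - M ^ (p - 1))) • Φ (B - A) := by gcongr
      _ = Φ A + (p * M ^ (p - 1) + p * (m ^ (p - 1) - M ^ (p - 1))) • Φ (B - A) := by
        rw [add_smul, add_assoc]
      _ ≤ Φ A + p • Φ (B - A) := by gcongr
      _ ≤ _ := hlow
  · have hup := OrderHomClass.mono Φ <| operatorMean_le_add_smul_sub hA h1 fun t ht =>
      Real.rpow_le_one_add_mul_rpow_bound (hspec1 t ht) (hspecM t ht) (Or.inr hp)
    have hlow := add_smul_sub_le_operatorMean hΦA hΦX fun t ht =>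
      Real.one_add_mul_sub_one_le_rpow (zero_lt_one.trans_le (hΦspec t ht)) (Or.inr hp)
    rw [hmap] at hup
    rw [← map_sub] at hlow
    -- Now `p - 1 ≥ 0`, so `m ^ (p - 1) ≤ 1`, hence the reversed sign of the correction.
    have hc : p * M ^ (p - 1) ≤ p + p * (M ^ (p - 1) - m ^ (p - 1)) := by
      have := Real.rpow_le_one hm.le hm1' (show 0 ≤ p - 1 by linarith)
      nlinarith
    calc _ ≤ Φ A + (p * M ^ (p - 1)) • Φ (B - A) := hup
      _ ≤ Φ A + (p + p * (M ^ (p - 1) - m ^ (p - 1))) • Φ (B - A) := by gcongr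
      _ = Φ A + p • Φ (B - A) + (p * (M ^ (p - 1) - m ^ (p - 1))) • Φ (B - A) := by
        rw [add_smul, add_assoc]
      _ ≤ _ := by gcongr
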